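/- A finite simple graph $G$ is a $(v,k,\lambda,\mu)$-strongly regular graph if it has $v$ vertices, is $k$-regular, any two adjacent vertices have exactly $\lambda$ common neighbours, and any two distinct non-adjacent vertices have exactly $\mu$ common neighbours. Fix any total order on $V(G)$. The clique complex of $G$ is the simplicial complex whose faces are the cliques of $G$; let $X_i$ be the set of its faces with $i+1$ vertices. For $F=\{x_0<\dots<x_r\}$ put $[F:K]=(-1)^j$ if $K\subset F$ and $F\setminus K=\{x_j\}$, and $[F:K]=0$ otherwise. The coboundary map $\delta_i:\mathbb{R}^{X_i}\to\mathbb{R}^{X_{i+1}}$ is given by $(\delta_i f)(H)=\sum_{F\in X_i}[H:F]\,f(F)$. **Theorem.** Let $G$ be a $(v,k,\lambda,\mu)$-strongly regular graph with $2\lambda+\mu+2>2k$. Then any four consecutive vertices of any induced cycle of $G$ of length at least four have a common neighbour in $G$, and the clique complex of $G$ satisfies $\ker\delta_1=\operatorname{im}\delta_0$. -/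

import Mathlib

/-- The clique complex of a graph: its faces are the (nonempty) cliques. The empty face, which
plays no role in the coboundary maps in degrees `0` and `1`, is left out, as always for Mathlib's
`AbstractSimplicialComplex`. -/
def SimpleGraph.cliqueComplex {V : Type*} (G : SimpleGraph V) : AbstractSimplicialComplex V where
  faces := {F | F.Nonempty ∧ G.IsClique (F : Set V)}
  isRelLowerSet_faces := fun _ hF =>
    ⟨hF.1, fun _ hKF hK => ⟨hK, hF.2.subset (Finset.coe_subset.2 hKF)⟩⟩
  singleton_mem v := ⟨Finset.singleton_nonempty v, by simp⟩

namespace AbstractSimplicialComplex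

/-- `X.Face i` is the type of `i`-dimensional faces of `X`, those with `i + 1` vertices. -/
def Face {V : Type*} (X : AbstractSimplicialComplex V) (i : ℕ) : Type _ :=
  {F : Finset V // F ∈ X.faces ∧ F.card = i + 1}

noncomputable instance {V : Type*} [Finite V] (X : AbstractSimplicialComplex V) (i : ℕ) :
    Fintype (X.Face i) :=
  haveI : Finite (X.Face i) := Subtype.finite
  Fintype.ofFinite _

/-- The sign `[F : K]`. If `F = {x₀ < x₁ < ⋯ < xᵢ}`, `K ⊆ F` and `F \ K = {xⱼ}`, then it is
`(-1) ^ j`, where `j` is the number of elements of `F` below `xⱼ`; otherwise it is `0`. (At most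
one term of the sum is nonzero.) -/
noncomputable def incidence {V : Type*} [LinearOrder V] (F K : Finset V) : ℝ :=
  ∑ x ∈ F, if K ⊆ F ∧ F \ K = {x} then (-1 : ℝ) ^ (F.filter (· < x)).card else 0

/-- The coboundary matrix `δ i`, with rows indexed by the `(i + 1)`-dimensional faces, columns by
the `i`-dimensional faces, and entries `[H : F]`. -/
noncomputable def coboundary {V : Type*} [LinearOrder V] (X : AbstractSimplicialComplex V)
    (i : ℕ) : Matrix (X.Face (i + 1)) (X.Face i) ℝ :=
  Matrix.of fun H F => incidence H.1 F.1

/-- The coboundary map `ℝ^{X_i} → ℝ^{X_{i+1}}` given by the matrix `δ i`. -/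
noncomputable def coboundaryMap {V : Type*} [Finite V] [LinearOrder V]
    (X : AbstractSimplicialComplex V) (i : ℕ) :
    (X.Face i → ℝ) →ₗ[ℝ] (X.Face (i + 1) → ℝ) :=
  (X.coboundary i).mulVecLin

end AbstractSimplicialComplex

/-! Suppose `a, b, c, d` is an induced path, or a 4-cycle, with no common neighbour. Inside `N(b)`,
the set `N(a) ∩ N(c)` misses `N(d)`, and `N(a) ∪ N(c)` misses `a` and `c`. Adding the two resulting
bounds by `k` gives `2λ + μ + 2 ≤ 2k`, a contradiction.

For cohomology, a common neighbour `w` cones off the path, so `a, b, c, d` deforms through three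
triangles to `a, w, d`. Repeating this shortens any closed walk to length at most two, where an
antisymmetric function sums to zero. A 1-cocycle thus has zero sum on closed walks and is the
coboundary of a potential. -/

/-- In a strongly regular graph with `2 * k < 2 * l + m + 2`, the vertices of a walk `a, b, c, d`
with `a, c` and `b, d` distinct and non-adjacent have a common neighbour. -/
theorem SimpleGraph.IsSRGWith.exists_common_neighbor {V : Type*} [Fintype V]
    {G : SimpleGraph V} [DecidableRel G.Adj] {v k l m : ℕ} (hG : G.IsSRGWith v k l m)
    (h : 2 * k < 2 * l + m + 2) {a b c d : V} (hab : G.Adj a b) (hbc : G.Adj b c)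
    (hcd : G.Adj c d) (hac : a ≠ c) (hac' : ¬ G.Adj a c) (hbd : b ≠ d) (hbd' : ¬ G.Adj b d) :
    ∃ w, G.Adj w a ∧ G.Adj w b ∧ G.Adj w c ∧ G.Adj w d := by
  classical
  by_contra! hw
  have card_inter (x y : V) : (G.neighborFinset x ∩ G.neighborFinset y).card =
      Fintype.card (G.commonNeighbors x y) := by
    rw [← Set.toFinset_card]
    congr 1
    ext z
    simp [SimpleGraph.mem_commonNeighbors]
  set A := G.neighborFinset b ∩ G.neighborFinset a with hA
  set C := G.neighborFinset b ∩ G.neighborFinset c with hC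
  set D := G.neighborFinset b ∩ G.neighborFinset d with hD
  have hAcard : A.card = l := by rw [hA, card_inter, hG.of_adj _ _ hab.symm]
  have hCcard : C.card = l := by rw [hC, card_inter, hG.of_adj _ _ hbc]
  have hDcard : D.card = m := by rw [hD, card_inter, hG.of_not_adj hbd hbd']
  have hk : (G.neighborFinset b).card = k := hG.regular.degree_eq b
  have hdisj : Disjoint (A ∩ C) D := by
    rw [Finset.disjoint_left]
    intro w hAC hwD
    simp only [hA, hC, hD, Finset.mem_inter, SimpleGraph.mem_neighborFinset] at hAC hwD
    exact hw w hAC.1.2.symm hAC.1.1.symm hAC.2.2.symm hwD.2.symm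
  have h₁ : (A ∩ C).card + D.card ≤ k := by
    rw [← Finset.card_union_of_disjoint hdisj, ← hk]
    refine Finset.card_le_card (Finset.union_subset ?_ Finset.inter_subset_left)
    exact Finset.inter_subset_left.trans Finset.inter_subset_left
  have hdisj' : Disjoint (A ∪ C) {a, c} := by
    rw [Finset.disjoint_left]
    intro w hAC hwac
    simp only [hA, hC, Finset.mem_union, Finset.mem_inter, SimpleGraph.mem_neighborFinset] at hAC
    simp only [Finset.mem_insert, Finset.mem_singleton] at hwac
    rcases hwac with rfl | rfl
    · simp [SimpleGraph.adj_comm G c, hac'] at hAC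
    · simp [hac'] at hAC
  have h₂ : (A ∪ C).card + 2 ≤ k := by
    rw [← Finset.card_pair hac, ← Finset.card_union_of_disjoint hdisj', ← hk]
    refine Finset.card_le_card (Finset.union_subset
      (Finset.union_subset Finset.inter_subset_left Finset.inter_subset_left) ?_)
    intro x hx
    simp only [Finset.mem_insert, Finset.mem_singleton] at hx
    rcases hx with rfl | rfl
    · simpa using hab.symm
    · simpa using hbc
  -- By inclusion-exclusion, `h₁` and `h₂` add up to `2 * l + m + 2 ≤ 2 * k`.
  have h₃ := Finset.card_union_add_card_inter A C
  lia

/-! ### Shortening walks, and potentials -/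

namespace SimpleGraph

variable {V : Type*} {G : SimpleGraph V}

/-- The sum of a function on ordered pairs of vertices along a walk. -/
def Walk.dartSum (g : V → V → ℝ) : ∀ {u v : V}, G.Walk u v → ℝ
  | _, _, .nil => 0
  | _, _, .cons (u := u) (v := w) _ p => g u w + Walk.dartSum g p

theorem Walk.dartSum_append (g : V → V → ℝ) {u v w : V} (p : G.Walk u v) (q : G.Walk v w) :
    (p.append q).dartSum g = p.dartSum g + q.dartSum g := by
  induction p with
  | nil => simp [dartSum]
  | cons h p ih => simp [dartSum, ih, add_assoc]

theorem Walk.dartSum_reverse {g : V → V → ℝ} (hg : ∀ x y, g x y = -g y x) {u v : V}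
    (p : G.Walk u v) : p.reverse.dartSum g = -p.dartSum g := by
  induction p with
  | nil => simp [dartSum]
  | cons h p ih =>
    rw [Walk.reverse_cons, dartSum_append, ih]
    simp only [dartSum]
    rw [hg]
    ring

/-- If every walk `a, b, c, d` without shortcuts has a common neighbour, then a cocycle has the
same sum along any walk and along some walk of length at most two with the same ends. -/
theorem Walk.exists_length_le_two_dartSum_eq
    (hG : ∀ a b c d, G.Adj a b → G.Adj b c → G.Adj c d → a ≠ c → ¬ G.Adj a c → b ≠ d →
      ¬ G.Adj b d → ∃ w, G.Adj w a ∧ G.Adj w b ∧ G.Adj w c ∧ G.Adj w d)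
    {g : V → V → ℝ} (hg : ∀ x y, g x y = -g y x)
    (hcocycle : ∀ x y z, G.Adj x y → G.Adj y z → G.Adj x z → g x y + g y z = g x z)
    {u v : V} (p : G.Walk u v) :
    ∃ q : G.Walk u v, q.length ≤ 2 ∧ q.dartSum g = p.dartSum g := by
  induction p with
  | nil => exact ⟨.nil, by simp, rfl⟩
  | @cons a b d hab p ih =>
    obtain ⟨q, hq, hsum⟩ := ih
    simp only [dartSum, ← hsum]
    match q, hq with
    | .nil, _ => exact ⟨.cons hab .nil, by simp, rfl⟩
    | .cons hbd .nil, _ => exact ⟨.cons hab (.cons hbd .nil), by simp, rfl⟩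
    | .cons (v := c) hbc (.cons hcd .nil), _ =>
      by_cases hac : a = c
      · subst hac
        exact ⟨.cons hcd .nil, by simp, by simp only [dartSum]; linarith [hg a b]⟩
      by_cases hac' : G.Adj a c
      · exact ⟨.cons hac' (.cons hcd .nil), by simp, by
          simp only [dartSum]; linarith [hcocycle a b c hab hbc hac']⟩
      by_cases hbd : b = d
      · subst hbd
        exact ⟨.cons hab .nil, by simp, by simp only [dartSum]; linarith [hg b c]⟩
      by_cases hbd' : G.Adj b d
      · exact ⟨.cons hab (.cons hbd' .nil), by simp, by
          simp only [dartSum]; linarith [hcocycle b c d hbc hcd hbd']⟩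
      -- In the three triangles at `w`, the terms `g b w` and `g c w` telescope away.
      obtain ⟨w, hwa, hwb, hwc, hwd⟩ := hG a b c d hab hbc hcd hac hac' hbd hbd'
      refine ⟨.cons hwa.symm (.cons hwd .nil), by simp, ?_⟩
      simp only [dartSum]
      linarith [hcocycle a b w hab hwb.symm hwa.symm, hcocycle b c w hbc hwc.symm hwb.symm,
        hcocycle c d w hcd hwd.symm hwc.symm, hg w d]
    | .cons _ (.cons _ (.cons _ q)), hq => simp at hq

theorem Walk.dartSum_eq_zero_of_length_le_two {g : V → V → ℝ} (hg : ∀ x y, g x y = -g y x)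
    {u : V} (p : G.Walk u u) (hp : p.length ≤ 2) : p.dartSum g = 0 := by
  match p, hp with
  | .nil, _ => rfl
  | .cons h .nil, _ => exact (G.irrefl h).elim
  | .cons (v := w) _ (.cons _ .nil), _ => simp only [dartSum]; linarith [hg u w]
  | .cons _ (.cons _ (.cons _ q)), hp => simp at hp

/-- A function whose sums along closed walks vanish is a difference of potentials. -/
theorem exists_potential {g : V → V → ℝ} (hg : ∀ x y, g x y = -g y x)
    (hclosed : ∀ (u : V) (p : G.Walk u u), p.dartSum g = 0) :
    ∃ φ : V → ℝ, ∀ x y, G.Adj x y → g x y = φ y - φ x := by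
  have hreach (x : V) : G.Reachable (G.connectedComponentMk x).out x :=
    ConnectedComponent.exact (Quot.out_eq _)
  have key (r x : V) (p q : G.Walk r x) : p.dartSum g = q.dartSum g := by
    have := hclosed r (p.append q.reverse)
    rw [Walk.dartSum_append, Walk.dartSum_reverse hg] at this
    linarith
  refine ⟨fun x => (hreach x).some.dartSum g, fun x y hxy => ?_⟩
  have hcomp : G.connectedComponentMk x = G.connectedComponentMk y :=
    ConnectedComponent.sound hxy.reachable
  -- The base point `r` is a variable because the chosen roots for `x` and `y` are only
  -- propositionally equal.
  have hroot (r : V) (hr : r = (G.connectedComponentMk x).out) (q : G.Walk r y) :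
      q.dartSum g = (hreach x).some.dartSum g + g x y := by
    subst hr
    rw [key _ _ q ((hreach x).some.append (.cons hxy .nil)), Walk.dartSum_append]
    simp [Walk.dartSum]
  have := hroot _ (by rw [hcomp]) (hreach y).some
  simp only
  linarith

end SimpleGraph

/-! ### Explicit coboundary formulas in degrees 0 and 1 -/

namespace AbstractSimplicialComplex

variable {V : Type*}

open Classical in
/-- The extension by zero of a cochain to all finite sets. -/
noncomputable def extend (X : AbstractSimplicialComplex V) {i : ℕ} (f : X.Face i → ℝ)
    (F : Finset V) : ℝ :=
  if hF : F ∈ X.faces ∧ F.card = i + 1 then f ⟨F, hF⟩ else 0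

theorem extend_val (X : AbstractSimplicialComplex V) {i : ℕ} (f : X.Face i → ℝ)
    (F : X.Face i) : X.extend f F.1 = f F := by
  rw [extend, dif_pos F.2]; rfl

theorem coboundaryMap_apply [Finite V] [LinearOrder V] (X : AbstractSimplicialComplex V)
    (i : ℕ) (f : X.Face i → ℝ) (H : X.Face (i + 1)) :
    X.coboundaryMap i f H =
      ∑ x ∈ H.1, (-1 : ℝ) ^ (H.1.filter (· < x)).card * X.extend f (H.1.erase x) := by
  simp only [coboundaryMap, Matrix.mulVecLin_apply, Matrix.mulVec, dotProduct, coboundary,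
    Matrix.of_apply, incidence, Finset.sum_mul]
  rw [Finset.sum_comm]
  refine Finset.sum_congr rfl fun x hx => ?_
  have hcard : (H.1.erase x).card = i + 1 := by
    rw [Finset.card_erase_of_mem hx, H.2.2]; rfl
  have hface : H.1.erase x ∈ X.faces ∧ (H.1.erase x).card = i + 1 :=
    ⟨(X.isRelLowerSet_faces H.2.1).2 (Finset.erase_subset _ _) (Finset.card_pos.1 (by lia)), hcard⟩
  -- For fixed `x`, only the face `H \ {x}` has a nonzero sign.
  refine (Finset.sum_eq_single (⟨H.1.erase x, hface⟩ : X.Face i) ?_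
    fun hK => (hK (Finset.mem_univ (α := X.Face i) _)).elim).trans ?_
  · intro K _ hK
    rw [if_neg, zero_mul]
    rintro ⟨hKH, hdiff⟩
    refine hK (Subtype.ext ?_)
    change K.1 = H.1.erase x
    rw [Finset.erase_eq, ← hdiff, Finset.sdiff_sdiff_eq_self hKH]
  · exact congrArg₂ (· * ·) (if_pos ⟨Finset.erase_subset _ _, Finset.sdiff_erase_self hx⟩)
      (extend_val X f ⟨H.1.erase x, hface⟩).symm

variable [Finite V] [LinearOrder V] (X : AbstractSimplicialComplex V)

theorem coboundaryMap_zero_pair (f : X.Face 0 → ℝ) {x y : V} (hxy : x < y)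
    (H : X.Face 1) (hH : H.1 = {x, y}) :
    X.coboundaryMap 0 f H = X.extend f {y} - X.extend f {x} := by
  have e₁ : ({x, y} : Finset V).erase x = {y} := by grind
  have e₂ : ({x, y} : Finset V).erase y = {x} := by grind
  have c₁ : ({x, y} : Finset V).filter (· < x) = ∅ := by grind
  have c₂ : ({x, y} : Finset V).filter (· < y) = {x} := by grind
  rw [coboundaryMap_apply, hH, Finset.sum_pair hxy.ne, e₁, e₂, c₁, c₂]
  simp
  ring

theorem coboundaryMap_one_triple (f : X.Face 1 → ℝ) {x y z : V} (hxy : x < y) (hyz : y < z)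
    (H : X.Face 2) (hH : H.1 = {x, y, z}) :
    X.coboundaryMap 1 f H = X.extend f {y, z} - X.extend f {x, z} + X.extend f {x, y} := by
  have hxz := hxy.trans hyz
  have e₁ : ({x, y, z} : Finset V).erase x = {y, z} := by grind
  have e₂ : ({x, y, z} : Finset V).erase y = {x, z} := by grind
  have e₃ : ({x, y, z} : Finset V).erase z = {x, y} := by grind
  have c₁ : ({x, y, z} : Finset V).filter (· < x) = ∅ := by grind
  have c₂ : ({x, y, z} : Finset V).filter (· < y) = {x} := by grind
  have c₃ : ({x, y, z} : Finset V).filter (· < z) = {x, y} := by grind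
  rw [coboundaryMap_apply, hH, Finset.sum_insert (by grind), Finset.sum_pair hyz.ne,
    e₁, e₂, e₃, c₁, c₂, c₃, Finset.card_pair hxy.ne]
  simp
  ring

end AbstractSimplicialComplex

theorem Finset.exists_eq_pair_lt {V : Type*} [LinearOrder V] {F : Finset V} (hF : F.card = 2) :
    ∃ x y, x < y ∧ F = {x, y} := by
  obtain ⟨x, y, hne, rfl⟩ := Finset.card_eq_two.1 hF
  rcases hne.lt_or_gt with h | h
  · exact ⟨x, y, h, rfl⟩
  · exact ⟨y, x, h, Finset.pair_comm _ _⟩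

theorem Finset.exists_eq_triple_lt {V : Type*} [LinearOrder V] {F : Finset V}
    (hF : F.card = 3) : ∃ x y z, x < y ∧ y < z ∧ F = {x, y, z} := by
  have hne : F.Nonempty := Finset.card_pos.1 (by lia)
  obtain ⟨y, z, hyz, h⟩ := Finset.exists_eq_pair_lt (F := F.erase (F.min' hne)) (by
    rw [Finset.card_erase_of_mem (F.min'_mem hne), hF])
  refine ⟨F.min' hne, y, z, ?_, hyz, ?_⟩
  · exact F.min'_lt_of_mem_erase_min' hne (by simp [h])
  · rw [← h, Finset.insert_erase (F.min'_mem hne)]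

/-! ### First cohomology of the clique complex -/

namespace SimpleGraph

variable {V : Type*} {G : SimpleGraph V}

theorem pair_mem_cliqueComplex [DecidableEq V] {x y : V} (hxy : G.Adj x y) :
    ({x, y} : Finset V) ∈ G.cliqueComplex.faces ∧ ({x, y} : Finset V).card = 1 + 1 := by
  refine ⟨⟨by simp, ?_⟩, Finset.card_pair hxy.ne⟩
  simpa [SimpleGraph.isClique_pair] using fun _ => hxy

theorem triple_mem_cliqueComplex [DecidableEq V] {x y z : V} (hxy : G.Adj x y)
    (hyz : G.Adj y z) (hxz : G.Adj x z) :
    ({x, y, z} : Finset V) ∈ G.cliqueComplex.faces ∧ ({x, y, z} : Finset V).card = 2 + 1 := by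
  have := G.is3Clique_triple_iff.2 ⟨hxy, hxz, hyz⟩
  exact ⟨⟨by simp, this.isClique⟩, this.card_eq⟩

variable [LinearOrder V]

theorem coboundaryMap_one_comp_zero [Finite V] (f : G.cliqueComplex.Face 0 → ℝ) :
    G.cliqueComplex.coboundaryMap 1 (G.cliqueComplex.coboundaryMap 0 f) = 0 := by
  funext H
  obtain ⟨x, y, z, hxy, hyz, hH⟩ := Finset.exists_eq_triple_lt H.2.2
  have hclique : G.IsClique (({x, y, z} : Finset V) : Set V) := hH ▸ H.2.1.2
  have pair {a b : V} (hab : a < b) (ha : a ∈ ({x, y, z} : Finset V))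
      (hb : b ∈ ({x, y, z} : Finset V)) :
      G.cliqueComplex.extend (G.cliqueComplex.coboundaryMap 0 f) {a, b} =
        G.cliqueComplex.extend f {b} - G.cliqueComplex.extend f {a} := by
    have hadj : G.Adj a b := hclique ha hb hab.ne
    rw [← AbstractSimplicialComplex.coboundaryMap_zero_pair _ f hab
      ⟨{a, b}, pair_mem_cliqueComplex hadj⟩ rfl]
    exact AbstractSimplicialComplex.extend_val _ _ ⟨{a, b}, pair_mem_cliqueComplex hadj⟩
  rw [AbstractSimplicialComplex.coboundaryMap_one_triple _ _ hxy hyz H hH,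
    pair hxy (by simp) (by simp), pair hyz (by simp) (by simp),
    pair (hxy.trans hyz) (by simp) (by simp)]
  simp

/-- The antisymmetric function on ordered pairs of vertices given by a `1`-cochain. -/
noncomputable def orientedCochain (f : G.cliqueComplex.Face 1 → ℝ) (x y : V) : ℝ :=
  if x < y then G.cliqueComplex.extend f {x, y}
  else if y < x then -G.cliqueComplex.extend f {y, x} else 0

theorem orientedCochain_antisymm (f : G.cliqueComplex.Face 1 → ℝ) (x y : V) :
    orientedCochain f x y = -orientedCochain f y x := by
  rcases lt_trichotomy x y with h | rfl | h <;> simp [orientedCochain, *, not_lt_of_gt]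

theorem orientedCochain_cocycle [Finite V] {f : G.cliqueComplex.Face 1 → ℝ}
    (hf : G.cliqueComplex.coboundaryMap 1 f = 0) (x y z : V) (hxy : G.Adj x y)
    (hyz : G.Adj y z) (hxz : G.Adj x z) :
    orientedCochain f x y + orientedCochain f y z = orientedCochain f x z := by
  have sorted {a b c : V} (hab : a < b) (hbc : b < c) (h₁ : G.Adj a b) (h₂ : G.Adj b c)
      (h₃ : G.Adj a c) :
      orientedCochain f a b + orientedCochain f b c = orientedCochain f a c := by
    have h := AbstractSimplicialComplex.coboundaryMap_one_triple _ f hab hbc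
      ⟨{a, b, c}, triple_mem_cliqueComplex h₁ h₂ h₃⟩ rfl
    rw [hf] at h
    change (0 : ℝ) = _ at h
    simp only [orientedCochain, hab, hbc, hab.trans hbc, if_true]
    linarith
  have s₁ := orientedCochain_antisymm f x y
  have s₂ := orientedCochain_antisymm f y z
  have s₃ := orientedCochain_antisymm f x z
  -- Of the eight sign patterns, two are cyclic and impossible; the other six reduce to `sorted` by
  -- antisymmetry.
  rcases hxy.ne.lt_or_gt with h₁ | h₁ <;> rcases hyz.ne.lt_or_gt with h₂ | h₂ <;>
    rcases hxz.ne.lt_or_gt with h₃ | h₃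
  · exact sorted h₁ h₂ hxy hyz hxz
  · exact (lt_asymm (h₁.trans h₂) h₃).elim
  · linarith [sorted h₃ h₂ hxz hyz.symm hxy]
  · linarith [sorted h₃ h₁ hxz.symm hxy hyz.symm]
  · linarith [sorted h₁ h₃ hxy.symm hxz hyz]
  · linarith [sorted h₂ h₃ hyz hxz.symm hxy.symm]
  · exact (lt_asymm (h₂.trans h₁) h₃).elim
  · linarith [sorted h₂ h₁ hyz.symm hxy.symm hxz.symm]

/-- If every walk `a, b, c, d` without shortcuts has a common neighbour, then the first cohomology
of the clique complex vanishes. -/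
theorem ker_coboundaryMap_one_eq_range [Finite V]
    (hG : ∀ a b c d, G.Adj a b → G.Adj b c → G.Adj c d → a ≠ c → ¬ G.Adj a c → b ≠ d →
      ¬ G.Adj b d → ∃ w, G.Adj w a ∧ G.Adj w b ∧ G.Adj w c ∧ G.Adj w d) :
    LinearMap.ker (G.cliqueComplex.coboundaryMap 1) =
      LinearMap.range (G.cliqueComplex.coboundaryMap 0) := by
  refine le_antisymm (fun f hf => ?_) ?_
  · rw [LinearMap.mem_ker] at hf
    have hanti := orientedCochain_antisymm f
    obtain ⟨φ, hφ⟩ := exists_potential (G := G) hanti fun u p => by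
      obtain ⟨q, hq, hsum⟩ := p.exists_length_le_two_dartSum_eq hG hanti
        (orientedCochain_cocycle hf)
      rw [← hsum, q.dartSum_eq_zero_of_length_le_two hanti hq]
    -- The sum over a one-element face just reads off `φ` at its vertex.
    let ψ : G.cliqueComplex.Face 0 → ℝ := fun F => ∑ x ∈ F.1, φ x
    have hψ (x : V) : G.cliqueComplex.extend ψ {x} = φ x := by
      rw [AbstractSimplicialComplex.extend,
        dif_pos ⟨G.cliqueComplex.singleton_mem x, Finset.card_singleton x⟩]
      exact Finset.sum_singleton _ _
    refine ⟨ψ, funext fun H => ?_⟩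
    obtain ⟨x, y, hxy, hH⟩ := Finset.exists_eq_pair_lt H.2.2
    have hadj : G.Adj x y := H.2.1.2 (by simp [hH]) (by simp [hH]) hxy.ne
    rw [AbstractSimplicialComplex.coboundaryMap_zero_pair _ _ hxy H hH, hψ, hψ, ← hφ x y hadj,
      orientedCochain, if_pos hxy, ← hH, AbstractSimplicialComplex.extend_val]
  · rintro _ ⟨f, rfl⟩
    exact coboundaryMap_one_comp_zero f

end SimpleGraph

/-- An induced cycle of length `n + 4 ≥ 4` is an embedding of the cycle graph on `Fin (n + 4)` as
an induced subgraph; its vertices are numbered cyclically (addition in `Fin (n + 4)` is modulo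
`n + 4`), so `c i, c (i + 1), c (i + 2), c (i + 3)` are consecutive. -/
theorem mainTheorem3 {V : Type*} [Fintype V] [LinearOrder V] (G : SimpleGraph V)
    [DecidableRel G.Adj] (v k l m : ℕ) (hG : G.IsSRGWith v k l m)
    (h : 2 * k < 2 * l + m + 2) :
    (∀ (n : ℕ) (c : SimpleGraph.cycleGraph (n + 4) ↪g G) (i : Fin (n + 4)),
      ∃ w : V, G.Adj w (c i) ∧ G.Adj w (c (i + 1)) ∧ G.Adj w (c (i + 2)) ∧
        G.Adj w (c (i + 3))) ∧
    LinearMap.ker (G.cliqueComplex.coboundaryMap 1) =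
      LinearMap.range (G.cliqueComplex.coboundaryMap 0) := by
  refine ⟨fun n c i => ?_, SimpleGraph.ker_coboundaryMap_one_eq_range
    fun a b c d h₁ h₂ h₃ h₄ h₅ h₆ h₇ => hG.exists_common_neighbor h h₁ h₂ h₃ h₄ h₅ h₆ h₇⟩
  have v1 : ((1 : Fin (n + 4)) : ℕ) = 1 := Nat.mod_eq_of_lt (by lia)
  have v2 : ((2 : Fin (n + 4)) : ℕ) = 2 := Nat.mod_eq_of_lt (by lia)
  have v3 : ((3 : Fin (n + 4)) : ℕ) = 3 := Nat.mod_eq_of_lt (by lia)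
  have e2 : i + 2 = i + 1 + 1 := by rw [add_assoc]; congr 1
  have e3 : i + 3 = i + 1 + 2 := by rw [add_assoc]; congr 1
  have e3' : i + 3 = i + 2 + 1 := by rw [add_assoc]; congr 1
  have step (j : Fin (n + 4)) : G.Adj (c j) (c (j + 1)) := by
    rw [c.map_adj_iff, SimpleGraph.cycleGraph_adj]
    simp
  have two_ne (j : Fin (n + 4)) : c j ≠ c (j + 2) := by
    intro hj
    have := c.injective hj
    rw [left_eq_add, Fin.ext_iff, v2] at this
    simp at this
  have two_not_adj (j : Fin (n + 4)) : ¬ G.Adj (c j) (c (j + 2)) := by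
    rw [c.map_adj_iff, SimpleGraph.cycleGraph_adj]
    -- Adjacency would force `3 = 0` or `2 = 1` modulo `n + 4`; length at least four excludes both.
    rintro (hj | hj)
    · have h3 : (3 : Fin (n + 4)) = 0 := by
        have : (3 : Fin (n + 4)) = 2 + 1 := by congr 1
        rw [this, ← hj]; abel
      rw [Fin.ext_iff, v3] at h3
      simp at h3
    · rw [add_sub_cancel_left, Fin.ext_iff, v1, v2] at hj
      lia
  exact hG.exists_common_neighbor h (step i) (e2 ▸ step (i + 1)) (e3' ▸ step (i + 2))
    (two_ne i) (two_not_adj i) (e3 ▸ two_ne (i + 1)) (e3 ▸ two_not_adj (i + 1))
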